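/- Let $\Pi_\sigma=\{s\in\mathbb C:\operatorname{Re}s>\sigma\}$ and $\Pi=\Pi_0$, and let $U_1=\{z\in\mathbb C:|z|<1\}$. For a Dirichlet series $f(s)=\sum_{n=1}^{\infty}a_n n^{-s}$ that converges in $\Pi$, let $P_k(s)=\sum_{n=1}^{k}a_n n^{-s}$, $k\ge 1$, be its partial sums. For a domain $G\subset\mathbb C$, the Rogosinski abscissa $\mathbf r(G)$ is the infimum of those $\sigma\ge 0$ with the following property: for every function $f\in H^\infty(\Pi)$ (bounded and holomorphic in $\Pi$) that is the sum in $\Pi$ of such a series and satisfies $f(\Pi)\subset G$, one has $P_k(\Pi_\sigma)\subset G$ for all $k\ge 1$. The abscissa $\mathbf r_a(G)$ is defined in the same manner, with the functions $f$ now ranging over the sums of all Dirichlet series that converge absolutely in $\Pi$ and satisfy $f(\Pi)\subset G$. Theorem 2.5. Let $G\subset\mathbb C$ be a convex domain (non-empty and open, not necessarily bounded) with $G\neq\mathbb C$. Then $\mathbf r_a(G)=\mathbf r(U_1)$. This holds both when all such absolutely convergent series are admitted in the definition of $\mathbf r_a(G)$ and when only those with $f\in H^\infty(\Pi)$ are admitted.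 -/

import Mathlib

open Set Filter Topology

/-- The half-plane `Π_σ = {s : Re s > σ}`; the right half-plane `Π` is `halfPlane 0`. -/
def halfPlane (σ : ℝ) : Set ℂ := {s : ℂ | σ < s.re}

/-- The partial sum `P_k(s) = ∑_{n=1}^k a_n / n^s` (the value `a 0` plays no role). -/
noncomputable def dirichletPartialSum (a : ℕ → ℂ) (k : ℕ) (s : ℂ) : ℂ :=
  ∑ n ∈ Finset.Icc 1 k, a n / (n : ℂ) ^ s

/-- The Dirichlet series `∑_{n≥1} a_n / n^s` converges (possibly only conditionally) at every
point of the right half-plane, and its sum there is `f`. -/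
def IsDirichletSum (a : ℕ → ℂ) (f : ℂ → ℂ) : Prop :=
  ∀ s ∈ halfPlane 0, Tendsto (fun k : ℕ => dirichletPartialSum a k s) atTop (𝓝 (f s))

/-- The Dirichlet series `∑_{n≥1} a_n / n^s` converges absolutely at every point of the right
half-plane. (Unconditional summability of complex numbers is absolute summability.) -/
def IsAbsolutelyConvergent (a : ℕ → ℂ) : Prop :=
  ∀ s ∈ halfPlane 0, LSeriesSummable a s

/-- `f` is in `H^∞(Π)`: holomorphic and bounded in the right half-plane. -/
def MemHInfty (f : ℂ → ℂ) : Prop :=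
  DifferentiableOn ℂ f (halfPlane 0) ∧ ∃ M : ℝ, ∀ s ∈ halfPlane 0, ‖f s‖ ≤ M

/-- For a class `C` of Dirichlet series (given by coefficients `a` and sum `f`): the set of all
`σ ≥ 0` such that, for each series of the class whose sum maps `Π` into `G`, all the partial
sums `P_k`, `k ≥ 1`, map `Π_σ` into `G`. -/
def rogosinskiSet (C : (ℕ → ℂ) → (ℂ → ℂ) → Prop) (G : Set ℂ) : Set ℝ :=
  {σ : ℝ | 0 ≤ σ ∧ ∀ (a : ℕ → ℂ) (f : ℂ → ℂ), IsDirichletSum a f → C a f →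
    MapsTo f (halfPlane 0) G →
      ∀ k : ℕ, 1 ≤ k → MapsTo (dirichletPartialSum a k) (halfPlane σ) G}

/-- The infimum of `rogosinskiSet C G`, in the extended reals (so the infimum of the empty set
would be `∞` and not a junk value). -/
noncomputable def rogosinskiAbscissaOf (C : (ℕ → ℂ) → (ℂ → ℂ) → Prop) (G : Set ℂ) : EReal :=
  sInf ((fun σ : ℝ => (σ : EReal)) '' rogosinskiSet C G)

/-- The Rogosinski abscissa `r(G)`: over all `f ∈ H^∞(Π)` that are the sum in `Π` of a
convergent Dirichlet series. -/
noncomputable def rogosinskiAbscissa (G : Set ℂ) : EReal :=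
  rogosinskiAbscissaOf (fun _ f => MemHInfty f) G

/-- The Rogosinski abscissa `r_a(G)`: over all Dirichlet series that converge absolutely in `Π`;
the sum need not be bounded. -/
noncomputable def rogosinskiAbscissaAbs (G : Set ℂ) : EReal :=
  rogosinskiAbscissaOf (fun a _ => IsAbsolutelyConvergent a) G

/-- The variant of `r_a(G)` over those Dirichlet series that converge absolutely in `Π` and
whose sum is moreover in `H^∞(Π)`. -/
noncomputable def rogosinskiAbscissaAbsBounded (G : Set ℂ) : EReal :=
  rogosinskiAbscissaOf (fun a f => IsAbsolutelyConvergent a ∧ MemHInfty f) G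

/-! Every class involved leads to one condition on `σ` that does not mention the domain,
`PositivityTransfer σ`.

Necessity (`positivityTransfer_of_mem_rogosinskiSet`): choose a disc in `G` with a point `p ∉ G` on
its boundary. If a series `b` with `Re ≥ c` has a partial sum value `w` with `Re w < 0`, a small
affine copy of `b` based at `p` stays in the disc. The images of `w` and `-w` both lie in `G` and
have midpoint `p`, against convexity.

Sufficiency (`PositivityTransfer.mem_rogosinskiSet`): a partial sum value outside `G` is separated
from `G` by a line, which turns the claim into one about positive real parts.

For the disc, conditionally convergent bounded series must also be covered. Gaussian averaging along
vertical lines makes them absolutely convergent, preserves the bound, and perturbs each partial sum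
arbitrarily little (`PositivityTransfer.mem_rogosinskiSet_ball`). -/

/-! ### Half-planes; affine changes and translates of Dirichlet series. -/

theorem isOpen_halfPlane (σ : ℝ) : IsOpen (halfPlane σ) :=
  isOpen_lt continuous_const Complex.continuous_re

theorem convex_halfPlane (σ : ℝ) : Convex ℝ (halfPlane σ) :=
  convex_halfSpace_re_gt σ

theorem isPreconnected_halfPlane (σ : ℝ) : IsPreconnected (halfPlane σ) :=
  (convex_halfPlane σ).isPreconnected

theorem dirichletPartialSum_eq_sum_range (a : ℕ → ℂ) (k : ℕ) (s : ℂ) :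
    dirichletPartialSum a k s = ∑ n ∈ Finset.range (k + 1), LSeries.term a s n := by
  have h : Finset.range (k + 1) = insert 0 (Finset.Icc 1 k) := by
    ext n; simp; omega
  rw [h, Finset.sum_insert (by simp), LSeries.term_zero, zero_add]
  refine Finset.sum_congr rfl fun n hn => ?_
  rw [LSeries.term_of_ne_zero (by have := Finset.mem_Icc.1 hn; omega)]

/-- The Dirichlet coefficients of `s ↦ α * f s + β`. -/
noncomputable def affineCoeff (α β : ℂ) (a : ℕ → ℂ) : ℕ → ℂ :=
  α • a + β • LSeries.delta

theorem affineCoeff_one (α β : ℂ) (a : ℕ → ℂ) : affineCoeff α β a 1 = α * a 1 + β := by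
  simp [affineCoeff, LSeries.delta]

theorem LSeriesSummable_delta (s : ℂ) : LSeriesSummable LSeries.delta s :=
  summable_of_ne_finset_zero (s := {1}) fun n hn => by
    rw [LSeries.term_delta, if_neg (by simpa using hn)]

theorem LSeriesSummable.affineCoeff {a : ℕ → ℂ} {s : ℂ} (h : LSeriesSummable a s) (α β : ℂ) :
    LSeriesSummable (affineCoeff α β a) s :=
  (h.smul α).add ((LSeriesSummable_delta s).smul β)

theorem LSeries_affineCoeff {a : ℕ → ℂ} {s : ℂ} (h : LSeriesSummable a s) (α β : ℂ) :
    LSeries (affineCoeff α β a) s = α * LSeries a s + β := by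
  rw [affineCoeff, LSeries_add (h.smul α) ((LSeriesSummable_delta s).smul β), LSeries_smul,
    LSeries_smul, LSeries_delta, Pi.one_apply, mul_one]

theorem dirichletPartialSum_affineCoeff (α β : ℂ) (a : ℕ → ℂ) {k : ℕ} (hk : 1 ≤ k) (s : ℂ) :
    dirichletPartialSum (affineCoeff α β a) k s = α * dirichletPartialSum a k s + β := by
  simp only [dirichletPartialSum_eq_sum_range, affineCoeff, LSeries.term_add_apply,
    LSeries.term_smul_apply, LSeries.term_delta, Finset.sum_add_distrib,
    ← Finset.mul_sum]
  rw [Finset.sum_ite_eq', if_pos (by simp; omega), mul_one]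

/-- The coefficients `LSeries.term a w` are those of the translate of the Dirichlet series of `a`
by `w`. -/
theorem term_term (a : ℕ → ℂ) (w s : ℂ) :
    LSeries.term (LSeries.term a w) s = LSeries.term a (s + w) := by
  ext n
  rcases eq_or_ne n 0 with rfl | hn
  · simp
  · rw [LSeries.term_of_ne_zero hn, LSeries.term_of_ne_zero hn, LSeries.term_of_ne_zero hn,
      Complex.cpow_add _ _ (Nat.cast_ne_zero.2 hn), div_div, mul_comm]

theorem LSeriesSummable_term_iff (a : ℕ → ℂ) (w s : ℂ) :
    LSeriesSummable (LSeries.term a w) s ↔ LSeriesSummable a (s + w) := by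
  rw [LSeriesSummable, LSeriesSummable, term_term]

theorem LSeries_term (a : ℕ → ℂ) (w s : ℂ) :
    LSeries (LSeries.term a w) s = LSeries a (s + w) := by
  rw [LSeries, LSeries, term_term]

theorem dirichletPartialSum_term (a : ℕ → ℂ) (w : ℂ) (k : ℕ) (s : ℂ) :
    dirichletPartialSum (LSeries.term a w) k s = dirichletPartialSum a k (s + w) := by
  simp only [dirichletPartialSum_eq_sum_range, term_term]

theorem LSeriesSummable.tendsto_dirichletPartialSum {a : ℕ → ℂ} {s : ℂ}
    (h : LSeriesSummable a s) :
    Tendsto (fun k : ℕ => dirichletPartialSum a k s) atTop (𝓝 (LSeries a s)) := by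
  simp only [dirichletPartialSum_eq_sum_range]
  exact (tendsto_add_atTop_iff_nat 1).2 h.hasSum.tendsto_sum_nat

theorem IsDirichletSum.eq_LSeries {a : ℕ → ℂ} {f : ℂ → ℂ} (h : IsDirichletSum a f) {s : ℂ}
    (hs : s ∈ halfPlane 0) (ha : LSeriesSummable a s) : f s = LSeries a s :=
  tendsto_nhds_unique (h s hs) ha.tendsto_dirichletPartialSum

theorem LSeriesSummable.norm_LSeries_le {a : ℕ → ℂ} (h : LSeriesSummable a 0) {s : ℂ}
    (hs : s ∈ halfPlane 0) : ‖LSeries a s‖ ≤ ∑' n, ‖LSeries.term a 0 n‖ :=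
  tsum_of_norm_bounded h.norm.hasSum fun n =>
    LSeries.norm_term_le_of_re_le_re a (by simpa using (show (0 : ℝ) < s.re from hs).le) n

theorem LSeriesSummable.isAbsolutelyConvergent {a : ℕ → ℂ} (h : LSeriesSummable a 0) :
    IsAbsolutelyConvergent a := fun s hs =>
  h.of_re_le_re (by simpa using (show (0 : ℝ) < s.re from hs).le)

theorem LSeriesSummable.memHInfty {a : ℕ → ℂ} (h : LSeriesSummable a 0) :
    MemHInfty (LSeries a) := by
  refine ⟨(LSeries_differentiableOn a).mono fun s hs => ?_, _, fun s hs => h.norm_LSeries_le hs⟩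
  refine lt_of_le_of_lt h.abscissaOfAbsConv_le ?_
  exact_mod_cast (show (0 : ℝ) < s.re from hs)

theorem LSeriesSummable.isDirichletSum {a : ℕ → ℂ} (h : LSeriesSummable a 0) :
    IsDirichletSum a (LSeries a) := fun s hs =>
  (h.isAbsolutelyConvergent s hs).tendsto_dirichletPartialSum

/-! ### Strict positivity of real parts, and the constant term. -/

theorem differentiable_dirichletPartialSum (a : ℕ → ℂ) (k : ℕ) :
    Differentiable ℂ (dirichletPartialSum a k) := by
  have : dirichletPartialSum a k = fun s => ∑ n ∈ Finset.range (k + 1), LSeries.term a s n :=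
    funext fun s => dirichletPartialSum_eq_sum_range a k s
  rw [this]
  exact Differentiable.fun_sum fun n _ s => (LSeries.hasDerivAt_term a n s).differentiableAt

theorem tendsto_dirichletPartialSum_ofReal_atTop (a : ℕ → ℂ) {k : ℕ} (hk : 1 ≤ k) :
    Tendsto (fun x : ℝ => dirichletPartialSum a k x) atTop (𝓝 (a 1)) := by
  -- Truncating the coefficients makes the partial sum itself an L-series.
  set b : ℕ → ℂ := fun n => if n ≤ k then a n else 0 with hb
  have hterm (s : ℂ) (n : ℕ) (hn : n ∉ Finset.range (k + 1)) : LSeries.term b s n = 0 := by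
    have hn' : ¬ n ≤ k := by simpa [Nat.lt_succ_iff] using hn
    simp [LSeries.term_def, hb, hn']
  have hsum : LSeriesSummable b 0 := summable_of_ne_finset_zero (hterm 0)
  have h := LSeries.tendsto_atTop (f := b)
    (hsum.abscissaOfAbsConv_le.trans_lt (by simp [EReal.zero_lt_top]))
  have hb1 : b 1 = a 1 := by simp [hb, hk]
  rw [hb1] at h
  refine h.congr fun x => ?_
  rw [LSeries, tsum_eq_sum (hterm x), dirichletPartialSum_eq_sum_range]
  refine Finset.sum_congr rfl fun n hn => ?_
  have hn' : n ≤ k := by simpa [Nat.lt_succ_iff] using hn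
  simp [LSeries.term_def, hb, hn']

/-- A partial sum with nonnegative real part in a half-plane has positive real part there, provided
its constant term has positive real part. -/
theorem dirichletPartialSum_re_pos {a : ℕ → ℂ} {k : ℕ} (hk : 1 ≤ k) {σ : ℝ}
    (h : ∀ s ∈ halfPlane σ, 0 ≤ (dirichletPartialSum a k s).re) (h1 : 0 < (a 1).re)
    {s : ℂ} (hs : s ∈ halfPlane σ) : 0 < (dirichletPartialSum a k s).re := by
  refine lt_of_le_of_ne (h s hs) fun h0 => ?_
  -- The norm of `exp (-P)` is `exp (-Re P)`, so a zero of `Re P` is a maximum; then `Re P` vanishes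
  -- identically, against its limit `(a 1).re > 0` at `+∞`.
  have hmax : IsMaxOn (norm ∘ fun z => Complex.exp (-dirichletPartialSum a k z))
      (halfPlane σ) s := fun z hz => by
    have := h z hz
    simp [Complex.norm_exp, ← h0, this]
  have heq := Complex.norm_eqOn_of_isPreconnected_of_isMaxOn (isPreconnected_halfPlane σ)
    (isOpen_halfPlane σ)
    ((differentiable_dirichletPartialSum a k).neg.cexp.differentiableOn) hs hmax
  have hzero : ∀ z ∈ halfPlane σ, (dirichletPartialSum a k z).re = 0 := fun z hz => by
    have := heq hz
    simpa [Complex.norm_exp, ← h0] using this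
  have hlim := (Complex.continuous_re.tendsto _).comp (tendsto_dirichletPartialSum_ofReal_atTop a hk)
  have hlim0 : Tendsto (fun _ : ℝ => (0 : ℝ)) atTop (𝓝 (a 1).re) := by
    refine hlim.congr' ?_
    filter_upwards [eventually_gt_atTop σ] with x hx
    exact hzero x (by simpa [halfPlane] using hx)
  exact h1.ne (tendsto_nhds_unique tendsto_const_nhds hlim0)

/-- If an absolutely convergent Dirichlet series has positive real part in the right half-plane,
then so does its constant term. -/
theorem re_coeff_one_pos {a : ℕ → ℂ} (ha : IsAbsolutelyConvergent a)
    (hpos : ∀ s ∈ halfPlane 0, 0 < (LSeries a s).re) : 0 < (a 1).re := by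
  by_contra! h1
  -- Removing a constant term of nonpositive real part keeps the sum's real part positive.
  set b := affineCoeff 1 (-a 1) a with hb
  have hbs : ∀ s ∈ halfPlane 0, LSeriesSummable b s := fun s hs => (ha s hs).affineCoeff _ _
  have hbpos : ∀ s ∈ halfPlane 0, 0 < (LSeries b s).re := fun s hs => by
    have := hpos s hs
    rw [hb, LSeries_affineCoeff (ha s hs)]
    simp; linarith
  have hone : (1 : ℂ) ∈ halfPlane 0 := by simp [halfPlane]
  have hex : ∃ n, n ≠ 0 ∧ b n ≠ 0 := by
    by_contra! hall
    have h0 : LSeries b 1 = 0 := by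
      rw [LSeries_congr (g := 0) (fun {n} hn => hall n hn), LSeries_zero]; rfl
    have := hbpos 1 hone
    simp [h0] at this
  classical
  obtain ⟨hn0, hbn⟩ := Nat.find_spec hex
  have hmin : ∀ m < Nat.find hex, m ≠ 0 → b m = 0 := fun m hm hm0 => by
    by_contra hbm
    exact Nat.find_min hex hm ⟨hm0, hbm⟩
  set n := Nat.find hex
  have hn1 : n ≠ 1 := fun h => hbn (by rw [h, hb, affineCoeff_one]; ring)
  have hlog : Real.log n ≠ 0 := (Real.log_pos (by exact_mod_cast (by omega : 1 < n))).ne'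
  -- The vertical shift by `w` rotates the first nonzero term to `-‖b n‖`. That term dominates far
  -- to the right, which contradicts positivity.
  set w : ℂ := ((Complex.arg (-b n) / Real.log n : ℝ) : ℂ) * Complex.I with hw
  have hwre : w.re = 0 := by rw [hw, Complex.re_ofReal_mul, Complex.I_re, mul_zero]
  have hcpow : (n : ℂ) ^ w = Complex.exp (Complex.arg (-b n) * Complex.I) := by
    rw [Complex.cpow_def_of_ne_zero (Nat.cast_ne_zero.2 hn0), hw, ← Complex.ofReal_natCast,
      ← Complex.ofReal_log (Nat.cast_nonneg n)]
    congr 1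
    rw [Complex.ofReal_div]
    have : (Real.log n : ℂ) ≠ 0 := Complex.ofReal_ne_zero.2 hlog
    field_simp
  have hcn : LSeries.term b w n = -(‖b n‖ : ℂ) := by
    rw [LSeries.term_of_ne_zero hn0, hcpow, div_eq_iff (Complex.exp_ne_zero _), neg_mul,
      ← norm_neg, Complex.norm_mul_exp_arg_mul_I, neg_neg]
  obtain ⟨m, hm⟩ := Nat.exists_eq_succ_of_ne_zero hn0
  have habs : LSeries.abscissaOfAbsConv (LSeries.term b w) < ⊤ := by
    have hs : LSeriesSummable (LSeries.term b w) 1 :=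
      (LSeriesSummable_term_iff b w 1).2 (hbs _ (by simp [halfPlane, hwre]))
    exact hs.abscissaOfAbsConv_le.trans_lt (EReal.coe_lt_top _)
  have hlim := LSeries.tendsto_cpow_mul_atTop (f := LSeries.term b w) (n := m) (fun l hl => by
    rcases eq_or_ne l 0 with rfl | hl0
    · simp
    · rw [LSeries.term_of_ne_zero hl0, hmin l (by omega) hl0, zero_div]) habs
  rw [← Nat.succ_eq_add_one, ← hm, hcn] at hlim
  have hre := (Complex.continuous_re.tendsto _).comp hlim
  have hge : 0 ≤ (-(‖b n‖ : ℂ)).re := by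
    refine ge_of_tendsto hre ?_
    filter_upwards [eventually_gt_atTop 0] with x hx
    have hx' := hbpos (x + w) (by simpa [halfPlane, hwre] using hx)
    have hcast : ((m : ℂ) + 1) ^ (x : ℂ) = (((m + 1 : ℝ) ^ x : ℝ) : ℂ) := by
      rw [Complex.ofReal_cpow (by positivity)]; push_cast; rfl
    simp only [Function.comp_apply, LSeries_term, hcast, Complex.re_ofReal_mul]
    positivity
  have : 0 < ‖b n‖ := norm_pos_iff.2 hbn
  simp at hge
  exact hbn hge

/-! ### Gaussian smoothing along vertical lines. -/

/-- The coefficients of the convolution of a Dirichlet series with a Gaussian of variance `v` along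
vertical lines. -/
noncomputable def gaussianCoeff (v : NNReal) (a : ℕ → ℂ) (n : ℕ) : ℂ :=
  a n * Complex.exp (-(v * (Real.log n) ^ 2 / 2))

theorem norm_gaussianCoeff (v : NNReal) (a : ℕ → ℂ) (n : ℕ) :
    ‖gaussianCoeff v a n‖ = ‖a n‖ * Real.exp (-(v * (Real.log n) ^ 2 / 2)) := by
  rw [gaussianCoeff, norm_mul, Complex.norm_exp]
  have : (-(v * (Real.log n : ℂ) ^ 2 / 2)) = ((-(v * (Real.log n) ^ 2 / 2) : ℝ) : ℂ) := by
    push_cast; rfl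
  rw [this, Complex.ofReal_re]

/-- The terms of the convergent series at `s = 1` tend to zero, hence are bounded. -/
theorem IsDirichletSum.exists_norm_coeff_le {a : ℕ → ℂ} {f : ℂ → ℂ} (h : IsDirichletSum a f) :
    ∃ C : ℝ, ∀ n ≠ 0, ‖a n‖ ≤ C * n := by
  have h1 := h 1 (by simp [halfPlane])
  have hdiff : Tendsto (fun k : ℕ => a (k + 1) / ((k + 1 : ℕ) : ℂ)) atTop (𝓝 0) := by
    have := ((tendsto_add_atTop_iff_nat 1).2 h1).sub h1
    rw [sub_self] at this
    refine this.congr fun k => ?_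
    rw [dirichletPartialSum, Finset.sum_Icc_succ_top (by omega), dirichletPartialSum,
      add_sub_cancel_left, Complex.cpow_one]
  obtain ⟨C, hC⟩ := hdiff.norm.bddAbove_range
  refine ⟨C, fun n hn => ?_⟩
  obtain ⟨k, rfl⟩ := Nat.exists_eq_succ_of_ne_zero hn
  have := hC ⟨k, rfl⟩
  simp only [norm_div, Complex.norm_natCast] at this
  rwa [div_le_iff₀ (by positivity)] at this

theorem IsDirichletSum.LSeriesSummable_of_two_lt_re {a : ℕ → ℂ} {f : ℂ → ℂ}
    (h : IsDirichletSum a f) {s : ℂ} (hs : 2 < s.re) : LSeriesSummable a s := by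
  obtain ⟨C, hC⟩ := h.exists_norm_coeff_le
  refine LSeriesSummable_of_le_const_mul_rpow hs ⟨C, fun n hn => (hC n hn).trans_eq ?_⟩
  norm_num

theorem IsDirichletSum.LSeriesSummable_gaussianCoeff {a : ℕ → ℂ} {f : ℂ → ℂ}
    (h : IsDirichletSum a f) {v : NNReal} (hv : v ≠ 0) :
    LSeriesSummable (gaussianCoeff v a) 0 := by
  obtain ⟨C, hC⟩ := h.exists_norm_coeff_le
  have hv' : (0 : ℝ) < v := by positivity
  refine LSeriesSummable_of_le_const_mul_rpow (x := -1) (by simp)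
    ⟨C * Real.exp (9 / (2 * v)), fun n hn => ?_⟩
  have hn' : (0 : ℝ) < n := by positivity
  have hC0 : 0 ≤ C := by
    have := (norm_nonneg _).trans (hC 1 one_ne_zero)
    simpa using this
  have hexp : (n : ℝ) * Real.exp (-(v * (Real.log n) ^ 2 / 2)) ≤
      Real.exp (9 / (2 * v)) * (n : ℝ) ^ ((-1 : ℝ) - 1) := by
    rw [Real.rpow_def_of_pos hn']
    nth_rewrite 1 [← Real.exp_log hn']
    rw [← Real.exp_add, ← Real.exp_add, Real.exp_le_exp]
    -- Passing from `n` to `n ^ (-2)` costs three powers of `n`; `9 / (2 * v)` is the maximum of `3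
    -- * L - v * L ^ 2 / 2` over real `L`.
    have h9 : 3 * Real.log n - v * Real.log n ^ 2 / 2 ≤ 9 / (2 * v) := by
      rw [le_div_iff₀ (by positivity)]
      nlinarith [sq_nonneg (v * Real.log n - 3)]
    linarith
  rw [norm_gaussianCoeff]
  calc ‖a n‖ * Real.exp (-(v * (Real.log n) ^ 2 / 2))
      ≤ C * n * Real.exp (-(v * (Real.log n) ^ 2 / 2)) := by gcongr; exact hC n hn
    _ ≤ C * (Real.exp (9 / (2 * v)) * (n : ℝ) ^ ((-1 : ℝ) - 1)) := by
        rw [mul_assoc]; gcongr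
    _ = _ := by ring

theorem mem_halfPlane_add_ofReal_mul_I {σ : ℝ} {s : ℂ} (hs : s ∈ halfPlane σ) (t : ℝ) :
    s + t * Complex.I ∈ halfPlane σ := by
  simpa [halfPlane] using hs

theorem ContinuousOn.continuous_vertical {σ : ℝ} {f : ℂ → ℂ} (hf : ContinuousOn f (halfPlane σ))
    {s : ℂ} (hs : s ∈ halfPlane σ) : Continuous fun t : ℝ => f (s + t * Complex.I) :=
  hf.comp_continuous (by fun_prop) fun t => mem_halfPlane_add_ofReal_mul_I hs t

open MeasureTheory in
/-- Averaging a bounded holomorphic function along vertical lines yields a holomorphic function. -/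
theorem differentiableOn_integral_vertical {f : ℂ → ℂ} (hf : DifferentiableOn ℂ f (halfPlane 0))
    {M : ℝ} (hM : ∀ s ∈ halfPlane 0, ‖f s‖ ≤ M) (μ : Measure ℝ) [IsProbabilityMeasure μ] :
    DifferentiableOn ℂ (fun s => ∫ t : ℝ, f (s + t * Complex.I) ∂μ) (halfPlane 0) := by
  intro s hs
  have hs0 : 0 < s.re := hs
  have hr : 0 < s.re / 2 := by positivity
  have hball : ∀ z ∈ Metric.ball s (s.re / 2), s.re / 2 < z.re := fun z hz => by
    have h1 := (Complex.abs_re_le_norm (z - s)).trans_lt (mem_ball_iff_norm.1 hz)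
    have h2 := (abs_lt.1 h1).1
    rw [Complex.sub_re] at h2
    linarith
  have hballP : ∀ z ∈ Metric.ball s (s.re / 2), z ∈ halfPlane 0 := fun z hz =>
    hr.trans (hball z hz)
  have hderiv : ContinuousOn (deriv f) (halfPlane 0) :=
    (hf.deriv (isOpen_halfPlane 0)).continuousOn
  -- The dominating constant is Cauchy's estimate on discs of radius `s.re / 4`, which stay in the
  -- half-plane.
  have key := hasDerivAt_integral_of_dominated_loc_of_deriv_le (μ := μ) (𝕜 := ℂ)
    (F := fun z (t : ℝ) => f (z + t * Complex.I))
    (F' := fun z (t : ℝ) => deriv f (z + t * Complex.I)) (bound := fun _ => M / (s.re / 4))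
    (Metric.ball_mem_nhds s hr)
    (by
      filter_upwards [(isOpen_halfPlane 0).mem_nhds hs] with z hz
      exact (hf.continuousOn.continuous_vertical hz).aestronglyMeasurable)
    (Integrable.of_bound (hf.continuousOn.continuous_vertical hs).aestronglyMeasurable M
      (Eventually.of_forall fun t => hM _ (mem_halfPlane_add_ofReal_mul_I hs t)))
    (hderiv.continuous_vertical hs).aestronglyMeasurable
    (Eventually.of_forall fun t z hz => by
      have hsub : Metric.closedBall (z + t * Complex.I) (s.re / 4) ⊆ halfPlane 0 := fun u hu => by
        have h1 := (Complex.abs_re_le_norm (u - (z + t * Complex.I))).trans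
          (mem_closedBall_iff_norm.1 hu)
        have h2 := (abs_le.1 h1).1
        have h3 := hball z hz
        simp at h2
        show 0 < u.re
        linarith
      refine Complex.norm_deriv_le_of_forall_mem_sphere_norm_le (by positivity)
        (hf.diffContOnCl_ball hsub) fun u hu => ?_
      exact hM u (hsub (Metric.sphere_subset_closedBall hu)))
    (integrable_const _)
    (Eventually.of_forall fun t z hz => by
      have hz' := mem_halfPlane_add_ofReal_mul_I (hballP z hz) t
      exact ((hf.differentiableAt ((isOpen_halfPlane 0).mem_nhds hz')).hasDerivAt).comp_add_const
        z (t * Complex.I))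
  exact key.2.differentiableAt.differentiableWithinAt

open MeasureTheory ProbabilityTheory in
theorem integral_natCast_cpow_neg_gaussianReal (v : NNReal) {n : ℕ} (hn : n ≠ 0) :
    ∫ t : ℝ, (n : ℂ) ^ (-(t * Complex.I)) ∂(gaussianReal 0 v) =
      Complex.exp (-(v * (Real.log n) ^ 2 / 2)) := by
  have h := charFun_gaussianReal (μ := 0) (v := v) (-Real.log n)
  rw [charFun_apply_real] at h
  simp only [Complex.ofReal_zero, mul_zero, zero_mul, zero_sub, Complex.ofReal_neg, neg_sq] at h
  rw [← h]
  refine integral_congr_ae (Eventually.of_forall fun t => ?_)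
  simp only
  rw [Complex.cpow_def_of_ne_zero (Nat.cast_ne_zero.2 hn), ← Complex.ofReal_natCast,
    ← Complex.ofReal_log (Nat.cast_nonneg n)]
  congr 1
  ring

open MeasureTheory ProbabilityTheory in
theorem integral_gaussianReal_LSeries {a : ℕ → ℂ} {s : ℂ} (ha : LSeriesSummable a s)
    (v : NNReal) :
    ∫ t : ℝ, LSeries a (s + t * Complex.I) ∂(gaussianReal 0 v) =
      LSeries (gaussianCoeff v a) s := by
  have hterm (n : ℕ) (t : ℝ) : LSeries.term a (s + t * Complex.I) n =
      LSeries.term a s n * (n : ℂ) ^ (-(t * Complex.I)) := by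
    rcases eq_or_ne n 0 with rfl | hn
    · simp
    · rw [LSeries.term_of_ne_zero hn, LSeries.term_of_ne_zero hn,
        Complex.cpow_add _ _ (Nat.cast_ne_zero.2 hn), Complex.cpow_neg, div_mul_eq_div_div,
        div_eq_mul_inv]
  have hnorm (n : ℕ) (t : ℝ) : ‖LSeries.term a (s + t * Complex.I) n‖ = ‖LSeries.term a s n‖ := by
    simp [LSeries.norm_term_eq]
  have hmeas (n : ℕ) : AEStronglyMeasurable (fun t : ℝ => LSeries.term a (s + t * Complex.I) n)
      (gaussianReal 0 v) := by
    refine Continuous.aestronglyMeasurable ?_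
    have : Continuous fun z => LSeries.term a z n :=
      Differentiable.continuous fun z => (LSeries.hasDerivAt_term a n z).differentiableAt
    exact this.comp (by fun_prop)
  have h := hasSum_integral_of_summable_integral_norm (μ := gaussianReal 0 v)
    (F := fun n (t : ℝ) => LSeries.term a (s + t * Complex.I) n)
    (fun n => Integrable.of_bound (hmeas n) ‖LSeries.term a s n‖
      (Eventually.of_forall fun t => (hnorm n t).le))
    (by simpa [hnorm] using ha.norm)
  refine h.tsum_eq.symm.trans (tsum_congr fun n => ?_)
  rcases eq_or_ne n 0 with rfl | hn
  · simp
  · simp_rw [hterm]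
    rw [integral_const_mul, integral_natCast_cpow_neg_gaussianReal v hn,
      LSeries.term_of_ne_zero hn, LSeries.term_of_ne_zero hn, gaussianCoeff]
    ring

-- The smoothed series equals the Gaussian average of `f` where the original converges absolutely,
-- hence on all of `Π` by the identity theorem; averages inherit the bound.
open MeasureTheory ProbabilityTheory in
theorem IsDirichletSum.norm_LSeries_gaussianCoeff_le {a : ℕ → ℂ} {f : ℂ → ℂ}
    (h : IsDirichletSum a f) (hf : DifferentiableOn ℂ f (halfPlane 0)) {M : ℝ}
    (hM : ∀ s ∈ halfPlane 0, ‖f s‖ ≤ M) {v : NNReal} (hv : v ≠ 0) {s : ℂ}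
    (hs : s ∈ halfPlane 0) : ‖LSeries (gaussianCoeff v a) s‖ ≤ M := by
  have hQ := differentiableOn_integral_vertical hf hM (gaussianReal 0 v)
  have hL := (h.LSeriesSummable_gaussianCoeff hv).memHInfty.1
  have h3 : (3 : ℂ) ∈ halfPlane 0 := by simp [halfPlane]
  have heq := (hQ.analyticOnNhd (isOpen_halfPlane 0)).eqOn_of_preconnected_of_eventuallyEq
    (hL.analyticOnNhd (isOpen_halfPlane 0)) (isPreconnected_halfPlane 0) h3 (by
      filter_upwards [(isOpen_halfPlane 2).mem_nhds
        (show (3 : ℂ) ∈ halfPlane 2 by norm_num [halfPlane])] with z hz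
      rw [← integral_gaussianReal_LSeries (h.LSeriesSummable_of_two_lt_re hz) v]
      refine integral_congr_ae (Eventually.of_forall fun t => ?_)
      have hzt := mem_halfPlane_add_ofReal_mul_I hz t
      exact h.eq_LSeries (show (0 : ℝ) < _ from zero_lt_two.trans hzt) (h.LSeriesSummable_of_two_lt_re hzt))
  rw [← heq hs]
  refine (norm_integral_le_of_norm_le_const (C := M) (Eventually.of_forall fun t =>
    hM _ (mem_halfPlane_add_ofReal_mul_I hs t))).trans_eq ?_
  simp

theorem tendsto_dirichletPartialSum_gaussianCoeff (a : ℕ → ℂ) (k : ℕ) (s : ℂ) :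
    Tendsto (fun v : NNReal => dirichletPartialSum (gaussianCoeff v a) k s) (𝓝[≠] 0)
      (𝓝 (dirichletPartialSum a k s)) := by
  have hc : Continuous fun v : NNReal => dirichletPartialSum (gaussianCoeff v a) k s := by
    unfold dirichletPartialSum gaussianCoeff
    fun_prop
  have := hc.tendsto 0
  refine Tendsto.mono_left ?_ nhdsWithin_le_nhds
  simpa [dirichletPartialSum, gaussianCoeff] using this

/-! ### Positivity transfer and convex domains. -/

/-- Dirichlet series that are absolutely convergent on the imaginary axis and have real part bounded
below by a positive constant in the right half-plane have partial sums with nonnegative real part in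
`Π_σ`. -/
def PositivityTransfer (σ : ℝ) : Prop :=
  ∀ b : ℕ → ℂ, LSeriesSummable b 0 → ∀ c : ℝ, 0 < c → (∀ s ∈ halfPlane 0, c ≤ (LSeries b s).re) →
    ∀ k : ℕ, 1 ≤ k → ∀ s ∈ halfPlane σ, 0 ≤ (dirichletPartialSum b k s).re

theorem norm_one_sub_mul_lt_one {z : ℂ} {c M δ : ℝ} (hc : 0 < c) (hδ : 0 < δ) (hM : ‖z‖ ≤ M)
    (hz : c ≤ z.re) (hδM : δ * M ^ 2 ≤ c) : ‖1 - δ * z‖ < 1 := by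
  have hsq : ‖1 - δ * z‖ ^ 2 = 1 - 2 * δ * z.re + δ ^ 2 * ‖z‖ ^ 2 := by
    rw [Complex.sq_norm, Complex.sq_norm, Complex.normSq_apply, Complex.normSq_apply]
    simp
    ring
  have h1 : ‖z‖ ^ 2 ≤ M ^ 2 := by gcongr
  have h2 : δ ^ 2 * ‖z‖ ^ 2 ≤ δ * c := by
    calc δ ^ 2 * ‖z‖ ^ 2 ≤ δ ^ 2 * M ^ 2 := by gcongr
      _ = δ * (δ * M ^ 2) := by ring
      _ ≤ δ * c := by gcongr
  have h3 : δ * c ≤ δ * z.re := by gcongr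
  have h4 : 0 < δ * c := by positivity
  have h5 : ‖1 - δ * z‖ ^ 2 < 1 := by rw [hsq]; linarith
  exact (sq_lt_one_iff₀ (norm_nonneg _)).1 h5

/-- Every point of an open proper subset of the plane is the centre of a disc contained in the set
and having a point of the complement on its boundary. -/
theorem exists_ball_subset_of_mem {G : Set ℂ} (hopen : IsOpen G) (hproper : G ≠ univ) {q : ℂ}
    (hq : q ∈ G) : ∃ p ∉ G, q ≠ p ∧ Metric.ball q ‖q - p‖ ⊆ G := by
  obtain ⟨p, hp, hd⟩ := hopen.isClosed_compl.exists_infDist_eq_dist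
    (nonempty_compl.2 hproper) q
  refine ⟨p, hp, fun h => hp (h ▸ hq), fun z hz => ?_⟩
  by_contra hzG
  have := Metric.infDist_le_dist_of_mem (x := q) (show z ∈ Gᶜ from hzG)
  rw [hd, dist_comm q z, dist_eq_norm] at this
  exact (mem_ball_iff_norm.1 hz).not_ge (by rwa [← dist_eq_norm z q])

theorem positivityTransfer_of_mem_rogosinskiSet {G : Set ℂ} (hopen : IsOpen G)
    (hne : G.Nonempty) (hconv : Convex ℝ G) (hproper : G ≠ univ) {σ : ℝ}
    (hσ : σ ∈ rogosinskiSet (fun a f => IsAbsolutelyConvergent a ∧ MemHInfty f) G) :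
    PositivityTransfer σ := by
  intro b hb c hc hbc k hk s hs
  obtain ⟨q, hq⟩ := hne
  obtain ⟨p, hp, hqp, hball⟩ := exists_ball_subset_of_mem hopen hproper hq
  by_contra! hneg
  set w := dirichletPartialSum b k s with hw
  -- `c'` and `M` serve both the values of the series and the reflected point `-w`.
  set c' := min c (-w.re)
  set M := max (∑' n, ‖LSeries.term b 0 n‖) ‖w‖
  set δ := c' / (M ^ 2 + 1) with hδdef
  have hc' : 0 < c' := lt_min hc (by linarith)
  have hδ : 0 < δ := by positivity
  have hδM : δ * M ^ 2 ≤ c' := by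
    rw [hδdef, div_mul_eq_mul_div, div_le_iff₀ (by positivity)]
    nlinarith
  have hmem (z : ℂ) (hz : ‖z‖ ≤ M) (hz' : c' ≤ z.re) : p + δ * (q - p) * z ∈ G := by
    refine hball (mem_ball_iff_norm.2 ?_)
    have h1 : p + δ * (q - p) * z - q = -((q - p) * (1 - δ * z)) := by ring
    rw [h1, norm_neg, norm_mul]
    exact mul_lt_of_lt_one_right (norm_pos_iff.2 (sub_ne_zero.2 hqp))
      (norm_one_sub_mul_lt_one hc' hδ hz hz' hδM)
  have hsum := hb.affineCoeff (δ * (q - p)) p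
  have hG := hσ.2 _ _ hsum.isDirichletSum ⟨hsum.isAbsolutelyConvergent, hsum.memHInfty⟩
    (fun z hz => by
      rw [LSeries_affineCoeff (hb.isAbsolutelyConvergent z hz), add_comm]
      exact hmem _ ((hb.norm_LSeries_le hz).trans (le_max_left _ _))
        ((min_le_left _ _).trans (hbc z hz))) k hk hs
  rw [dirichletPartialSum_affineCoeff _ _ _ hk, ← hw] at hG
  have hG' := hmem (-w) (by rw [norm_neg]; exact le_max_right _ _) (min_le_right _ _)
  refine hp ?_
  have := hconv hG hG' (a := 1 / 2) (b := 1 / 2) (by norm_num) (by norm_num) (by norm_num)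
  convert this using 1
  simp only [Complex.real_smul]
  push_cast
  ring

/-- Translating by `c > 0` gives absolute convergence on the imaginary axis and adding `c` gives the
lower bound; then `c → 0`. -/
theorem PositivityTransfer.re_nonneg {σ : ℝ} (hσ : PositivityTransfer σ) {a : ℕ → ℂ}
    (ha : IsAbsolutelyConvergent a) (hpos : ∀ s ∈ halfPlane 0, 0 ≤ (LSeries a s).re) {k : ℕ}
    (hk : 1 ≤ k) {s : ℂ} (hs : s ∈ halfPlane σ) : 0 ≤ (dirichletPartialSum a k s).re := by
  have hle (c : ℝ) (hc : 0 < c) : 0 ≤ (dirichletPartialSum a k (s + c) + c).re := by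
    have hmem {z : ℂ} (hz : 0 ≤ z.re) : z + c ∈ halfPlane 0 := by
      show 0 < (z + c).re
      rw [Complex.add_re, Complex.ofReal_re]
      linarith
    have hsum (z : ℂ) (hz : 0 ≤ z.re) : LSeriesSummable (LSeries.term a c) z :=
      (LSeriesSummable_term_iff a c z).2 (ha _ (hmem hz))
    have := hσ _ ((hsum 0 le_rfl).affineCoeff 1 c) c hc (fun z hz => by
      have hz' : 0 ≤ z.re := (show (0 : ℝ) < z.re from hz).le
      rw [LSeries_affineCoeff (hsum z hz'), LSeries_term]
      have := hpos _ (hmem hz')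
      simpa using this) k hk s hs
    rwa [dirichletPartialSum_affineCoeff _ _ _ hk, dirichletPartialSum_term, one_mul] at this
  have hcont : Continuous fun c : ℝ => (dirichletPartialSum a k (s + c) + c).re := by
    have := (differentiable_dirichletPartialSum a k).continuous
    fun_prop
  have hlim := (hcont.tendsto 0).mono_left (nhdsWithin_le_nhds (s := Ioi 0))
  simp only [Complex.ofReal_zero, add_zero] at hlim
  exact ge_of_tendsto hlim (eventually_mem_nhdsWithin.mono hle)

theorem exists_re_mul_lt_of_notMem {G : Set ℂ} (hopen : IsOpen G) (hconv : Convex ℝ G) {z : ℂ}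
    (hz : z ∉ G) : ∃ ω : ℂ, ∀ x ∈ G, (ω * x).re < (ω * z).re := by
  obtain ⟨φ, hφ⟩ := geometric_hahn_banach_open_point hconv hopen hz
  have hrep (x : ℂ) : ((φ 1 - φ Complex.I * Complex.I) * x).re = φ x := by
    have hx : x = x.re • (1 : ℂ) + x.im • Complex.I := by simp [Complex.re_add_im]
    conv_rhs => rw [hx, map_add, map_smul, map_smul]
    simp
    ring
  exact ⟨φ 1 - φ Complex.I * Complex.I, fun x hx => by simpa only [hrep] using hφ x hx⟩

theorem PositivityTransfer.mem_rogosinskiSet {G : Set ℂ} (hopen : IsOpen G)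
    (hconv : Convex ℝ G) {σ : ℝ} (h0 : 0 ≤ σ) (hσ : PositivityTransfer σ) :
    σ ∈ rogosinskiSet (fun a _ => IsAbsolutelyConvergent a) G := by
  refine ⟨h0, fun a f hsum ha hmaps k hk s hs => ?_⟩
  by_contra hG
  obtain ⟨ω, hω⟩ := exists_re_mul_lt_of_notMem hopen hconv hG
  set z := dirichletPartialSum a k s with hz
  have habs : IsAbsolutelyConvergent (affineCoeff (-ω) (ω * z) a) :=
    fun u hu => (ha u hu).affineCoeff _ _
  have hpos : ∀ u ∈ halfPlane 0, 0 < (LSeries (affineCoeff (-ω) (ω * z) a) u).re :=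
    fun u hu => by
      have := hω _ (hmaps hu)
      rw [LSeries_affineCoeff (ha u hu), ← hsum.eq_LSeries hu (ha u hu), neg_mul,
        Complex.add_re, Complex.neg_re]
      linarith
  have := dirichletPartialSum_re_pos hk
    (fun u hu => hσ.re_nonneg habs (fun u hu => (hpos u hu).le) hk hu)
    (re_coeff_one_pos habs hpos) hs
  rw [dirichletPartialSum_affineCoeff _ _ _ hk, ← hz, neg_mul, neg_add_cancel] at this
  simp at this

/-! ### The unit disc and conditionally convergent series. -/

theorem re_one_sub_mul_coeff_one_pos {a : ℕ → ℂ} {f : ℂ → ℂ} (hsum : IsDirichletSum a f)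
    (hf : ∀ s ∈ halfPlane 0, ‖f s‖ < 1) {ω : ℂ} (hω : ‖ω‖ = 1) : 0 < (1 - ω * a 1).re := by
  have hmem {s : ℂ} (hs : s ∈ halfPlane 0) : 2 < (s + 3).re := by
    have : 0 < s.re := hs
    simp
    linarith
  have hs {s : ℂ} (hs : s ∈ halfPlane 0) : LSeriesSummable a (s + 3) :=
    hsum.LSeriesSummable_of_two_lt_re (hmem hs)
  -- Translation by 3 reaches absolute convergence and leaves the constant term unchanged.
  have := re_coeff_one_pos (a := LSeries.term (affineCoeff (-ω) 1 a) 3)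
    (fun s h => (LSeriesSummable_term_iff _ _ _).2 ((hs h).affineCoeff _ _))
    (fun s h => by
      have h3 : s + 3 ∈ halfPlane 0 := show (0 : ℝ) < _ from zero_lt_two.trans (hmem h)
      rw [LSeries_term, LSeries_affineCoeff (hs h), ← hsum.eq_LSeries h3 (hs h)]
      have h1 := Complex.re_le_norm (ω * f (s + 3))
      have h2 := hf _ h3
      rw [norm_mul, hω, one_mul] at h1
      simp only [neg_mul, Complex.add_re, Complex.neg_re, Complex.one_re]
      linarith)
  rw [LSeries.term_of_ne_zero one_ne_zero, affineCoeff_one] at this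
  simpa [sub_eq_neg_add] using this

theorem PositivityTransfer.re_one_sub_mul_nonneg {σ : ℝ} (hσ : PositivityTransfer σ)
    {a : ℕ → ℂ} {f : ℂ → ℂ} (hsum : IsDirichletSum a f)
    (hdiff : DifferentiableOn ℂ f (halfPlane 0)) (hf : ∀ s ∈ halfPlane 0, ‖f s‖ ≤ 1) {ω : ℂ}
    (hω : ‖ω‖ = 1) {k : ℕ} (hk : 1 ≤ k) {s : ℂ} (hs : s ∈ halfPlane σ) :
    0 ≤ (1 - ω * dirichletPartialSum a k s).re := by
  -- The factor `1 - c` makes the real part at least `c` after smoothing; the limits `v → 0` and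
  -- then `c → 0` undo both changes.
  have hle (c : ℝ) (hc : c ∈ Ioo (0 : ℝ) 1) :
      0 ≤ (1 - (1 - c) * ω * dirichletPartialSum a k s).re := by
    have hlim := (Complex.continuous_re.tendsto _).comp
      (((tendsto_dirichletPartialSum_gaussianCoeff a k s).const_mul ((1 - c) * ω)).const_sub 1)
    refine ge_of_tendsto hlim ?_
    filter_upwards [eventually_mem_nhdsWithin] with v hv
    have hb := hsum.LSeriesSummable_gaussianCoeff hv
    have := hσ _ (hb.affineCoeff (-((1 - c) * ω)) 1) c hc.1 (fun z hz => by
      rw [LSeries_affineCoeff (hb.isAbsolutelyConvergent z hz)]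
      have h1 := Complex.re_le_norm (((1 - c : ℝ) : ℂ) * ω * LSeries (gaussianCoeff v a) z)
      have h2 := hsum.norm_LSeries_gaussianCoeff_le hdiff hf hv hz
      have h3 : 0 ≤ 1 - c := by linarith [hc.2]
      rw [norm_mul, norm_mul, hω, mul_one, Complex.norm_of_nonneg h3, Complex.ofReal_sub,
        Complex.ofReal_one] at h1
      have h4 : (1 - c) * ‖LSeries (gaussianCoeff v a) z‖ ≤ 1 - c := mul_le_of_le_one_right h3 h2
      rw [neg_mul, Complex.add_re, Complex.neg_re, Complex.one_re]
      linarith) k hk s hs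
    rw [dirichletPartialSum_affineCoeff _ _ _ hk, neg_mul, neg_add_eq_sub] at this
    exact this
  have hcont : Continuous fun c : ℝ => (1 - (1 - c) * ω * dirichletPartialSum a k s).re := by
    fun_prop
  have hlim := (hcont.tendsto 0).mono_left (nhdsWithin_le_nhds (s := Ioi 0))
  simp only [Complex.ofReal_zero, sub_zero, one_mul] at hlim
  refine ge_of_tendsto hlim ?_
  filter_upwards [Ioo_mem_nhdsGT (zero_lt_one' ℝ)] with c hc using hle c hc

theorem PositivityTransfer.mem_rogosinskiSet_ball {σ : ℝ} (h0 : 0 ≤ σ)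
    (hσ : PositivityTransfer σ) :
    σ ∈ rogosinskiSet (fun _ f => MemHInfty f) (Metric.ball (0 : ℂ) 1) := by
  refine ⟨h0, fun a f hsum hf hmaps k hk s hs => ?_⟩
  have hlt : ∀ z ∈ halfPlane 0, ‖f z‖ < 1 := fun z hz => mem_ball_zero_iff.1 (hmaps hz)
  set P := dirichletPartialSum a k s with hP
  rw [mem_ball_zero_iff]
  rcases eq_or_ne P 0 with hP0 | hP0
  · simp [hP0]
  have hPn : (‖P‖ : ℂ) ≠ 0 := by simpa using hP0
  -- With this rotation, `ω * P = ‖P‖`, so positivity at `s` reads `‖P‖ < 1`.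
  set ω : ℂ := (‖P‖ : ℂ) / P with hωdef
  have hω : ‖ω‖ = 1 := by
    rw [hωdef, norm_div, Complex.norm_real, norm_norm, div_self (norm_ne_zero_iff.2 hP0)]
  have hpart (z : ℂ) : dirichletPartialSum (affineCoeff (-ω) 1 a) k z =
      1 - ω * dirichletPartialSum a k z := by
    rw [dirichletPartialSum_affineCoeff _ _ _ hk]
    ring
  have := dirichletPartialSum_re_pos (a := affineCoeff (-ω) 1 a) hk
    (fun z hz => by
      rw [hpart]
      exact hσ.re_one_sub_mul_nonneg hsum hf.1 (fun u hu => (hlt u hu).le) hω hk hz)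
    (by
      rw [affineCoeff_one, neg_mul, neg_add_eq_sub]
      exact re_one_sub_mul_coeff_one_pos hsum hlt hω) hs
  rw [hpart, ← hP, hωdef, div_mul_cancel₀ _ hP0] at this
  simpa using this

/-! ### Comparison of the classes and conclusion. -/

theorem rogosinskiSet_anti {C C' : (ℕ → ℂ) → (ℂ → ℂ) → Prop} (h : ∀ a f, C a f → C' a f)
    (G : Set ℂ) : rogosinskiSet C' G ⊆ rogosinskiSet C G :=
  fun _ hσ => ⟨hσ.1, fun a f hsum hC => hσ.2 a f hsum (h a f hC)⟩

theorem rogosinskiSet_ball_eq :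
    rogosinskiSet (fun _ f => MemHInfty f) (Metric.ball (0 : ℂ) 1) =
      {σ | 0 ≤ σ ∧ PositivityTransfer σ} := by
  refine Subset.antisymm (fun σ hσ => ⟨hσ.1, ?_⟩) fun σ hσ => hσ.2.mem_rogosinskiSet_ball hσ.1
  refine positivityTransfer_of_mem_rogosinskiSet Metric.isOpen_ball
    ⟨0, Metric.mem_ball_self one_pos⟩ (convex_ball 0 1) (fun h => ?_)
    (rogosinskiSet_anti (fun _ _ h => h.2) _ hσ)
  have : (1 : ℂ) ∈ Metric.ball (0 : ℂ) 1 := h ▸ mem_univ _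
  simp at this

theorem theorem2p5 (G : Set ℂ) (hopen : IsOpen G) (hne : G.Nonempty) (hconv : Convex ℝ G)
    (hproper : G ≠ Set.univ) :
    rogosinskiAbscissaAbs G = rogosinskiAbscissa (Metric.ball (0 : ℂ) 1) ∧
      rogosinskiAbscissaAbsBounded G = rogosinskiAbscissa (Metric.ball (0 : ℂ) 1) := by
  have hle : rogosinskiSet (fun a _ => IsAbsolutelyConvergent a) G ⊆
      rogosinskiSet (fun a f => IsAbsolutelyConvergent a ∧ MemHInfty f) G :=
    rogosinskiSet_anti (fun _ _ h => h.1) G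
  have hbdd : rogosinskiSet (fun a f => IsAbsolutelyConvergent a ∧ MemHInfty f) G ⊆
      {σ | 0 ≤ σ ∧ PositivityTransfer σ} := fun σ hσ =>
    ⟨hσ.1, positivityTransfer_of_mem_rogosinskiSet hopen hne hconv hproper hσ⟩
  have habs : {σ | 0 ≤ σ ∧ PositivityTransfer σ} ⊆
      rogosinskiSet (fun a _ => IsAbsolutelyConvergent a) G := fun σ hσ =>
    hσ.2.mem_rogosinskiSet hopen hconv hσ.1
  rw [rogosinskiAbscissaAbs, rogosinskiAbscissaAbsBounded, rogosinskiAbscissa,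
    rogosinskiAbscissaOf, rogosinskiAbscissaOf, rogosinskiAbscissaOf, rogosinskiSet_ball_eq,
    (hle.trans hbdd).antisymm habs, hbdd.antisymm (habs.trans hle)]
  exact ⟨rfl, rfl⟩
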